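/- **Setting.** Time is discrete and starts at $0$. There are $k$ underlay chains. A *ledger* is a finite list of blocks with strictly increasing timestamps; the entries of a block are transactions of the environment, protocol messages, and *snapshots*, a snapshot being a ledger of some chain together with its certificate. Two ledgers are *consistent* if one is a prefix of the other. The *observers* are clients, which go online and offline at will, and the honest validators of the chains (each chain has a possibly empty set of them), which are always online; at each time at which it is online, every observer outputs a ledger, called its view, of every chain. The remaining validators are adversarial and may put any entries on the ledgers, except that certificates cannot be forged. An *overlay protocol* consists of (i) a program for the honest validators which, given the chain of the validator and its history (its views of all chains and the entries input to it), decides at every time which protocol messages and which snapshots of its current views it writes to which chains; and (ii) a client rule which computes the client's overlay ledger, a finite list of transactions, from the client's history of views, and which only outputs transactions that occur (possibly inside snapshots) in these views. The network is *synchronous*: what an honest validator writes to a chain is input to every honest validator of this chain within a known delay $\Delta>0$, from time $0$ on; the environment and the adversary may also input entries to validators at any time. A chain (or the overlay) is *safe* in an execution if all ledgers of it that (online) observers, respectively clients, output at any times are pairwise consistent, and the ledger that one observer (client) outputs at a time is a prefix of those that it outputs later. A chain is *live* if it has an honest validator and every entry that has been input to all its honest validators by time $t$ is in the view of every online observer at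 every time $t'\ge t+T$; here $T>0$ is a known constant. The overlay is live with latency $T'$ if every transaction that has been input to all honest validators of all chains by time $t$ is in the overlay ledger of every client online at a time $t'\ge t+T'$. The underlay chains *generate certificates*: views are certified, every snapshot on a certified ledger or input to an honest validator is certified, and if a chain is safe, then all of its certified ledgers that exist in the execution are pairwise consistent. They *proceed in epochs*: if a chain is live, then in the views of online observers no block appears before the time given by its timestamp, an entry input by time $t$ to all honest validators of the chain is, at every time $t'\ge t+T$, in a block with timestamp at most $t+T$, and at every time $t'\ge t+T$ there is a block with timestamp at least $t$. For $s\in\{0,1\}^k$ let $\mathrm{ind}(s)=\{i: s_i=1\}$, and order $\{0,1\}^{2k}$, whose elements are written $(s,l)$ with $s,l\in\{0,1\}^k$, componentwise. For an overlay protocol $\Pi$ let $V^S_\Pi$ be the set of all $(s,l)$ such that $\Pi$ is safe in every execution in which the chains in $\mathrm{ind}(s)$ are safe and those in $\mathrm{ind}(l)$ are live, and let $V^L_\Pi$ be the set of all $(s,l)$ for which there is a constant $T'>0$ such that $\Pi$ is live with latency $T'$ in every such execution. The protocol $\Pi$ is *characterized* by the pair consisting of the set of minimal elements of $V^S_\Pi$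 and the set of minimal elements of $V^L_\Pi$. For $E\subseteq\{0,1\}^{2k}$ let $\langle E\rangle=\{w:\exists v\in E,\ v\le w\}$; a pair $(F^S,F^L)$ *dominates* $(E^S,E^L)$ if $\langle E^S\rangle\subseteq\langle F^S\rangle$ and $\langle E^L\rangle\subseteq\langle F^L\rangle$. **Theorem.** Let $k\ge 0$, $\Delta,T>0$, and let $E^S,E^L\subseteq\{0,1\}^{2k}$ be such that 1. every $(s,l)\in E^L$ satisfies $s=0^k$, and $(0^k,0^k)\notin E^L$; 2. for all $(0^k,l^1),(0^k,l^2)\in E^L$ and all $(s,l)\in E^S$, (a) either there are $i\in\mathrm{ind}(l^1)$ and $j\in\mathrm{ind}(l^2)$ with $s_i=l_i=s_j=l_j=1$, (b) or $\mathrm{ind}(l^1)\cap\mathrm{ind}(l^2)\cap\mathrm{ind}(s)\ne\emptyset$. Then, under synchrony, there is an overlay protocol characterized by a pair that dominates $(E^S,E^L)$. -/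

import Mathlib

/-! # Interchain consensus protocols under synchrony

Time is discrete and `0` is the start of the execution.  The underlay chains are indexed by
`Fin k`; transactions and protocol messages are bit strings, coded by natural numbers. -/

/-- An entry of an underlay ledger: a transaction of the environment, a message of the overlay
protocol, or a snapshot, that is, a ledger of chain `i` together with its certificate.
A ledger is a list of blocks `(timestamp, entries)`. -/
inductive Entry (k : ℕ) : Type where
  | tx (x : ℕ) : Entry k
  | note (m : ℕ) : Entry k
  | snapshot (i : Fin k) (L : List (ℕ × List (Entry k))) : Entry k

/-- A block: its timestamp (the starting time of its epoch) and its entries. -/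
abbrev Block (k : ℕ) : Type := ℕ × List (Entry k)

/-- A ledger of an underlay chain. -/
abbrev Ledger (k : ℕ) : Type := List (Block k)

/-- The ledgers of the `k` underlay chains that one observer outputs at one time. -/
abbrev Views (k : ℕ) : Type := Fin k → Ledger k

/-- Two ledgers are consistent if one of them is a prefix of the other. -/
def Consistent {α : Type} (L L' : List α) : Prop := L <+: L' ∨ L' <+: L

/-- The transaction `x` occurs in a ledger, possibly inside snapshots. -/
inductive Occurs {k : ℕ} (x : ℕ) : Ledger k → Prop where
  | here {L : Ledger k} {B : Block k} (hB : B ∈ L) (hx : Entry.tx x ∈ B.2) : Occurs x L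
  | nested {L L' : Ledger k} {B : Block k} {j : Fin k} (hB : B ∈ L)
      (hL : Entry.snapshot j L' ∈ B.2) (hx : Occurs x L') : Occurs x L

/-- What an honest validator can write to an underlay chain: a message of the overlay protocol,
or the certified ledger of chain `j` that it currently sees.  It cannot make up transactions. -/
inductive Post (k : ℕ) : Type where
  | note (m : ℕ) : Post k
  | snapshot (j : Fin k) : Post k

/-- The ledger entry written by a validator whose current views are `V`. -/
def Post.entry {k : ℕ} (V : Views k) : Post k → Entry k
  | .note m => .note m
  | .snapshot j => .snapshot j (V j)

/-- An overlay (interchain) protocol on `k` underlay chains.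

`send i h` lists the posts, each with the chain it is written to, that an honest validator of
chain `i` makes when `h` lists, for the times `0, …, t`, the ledgers it saw and the inputs it
received.  `output h` is the overlay ledger of a client when `h` lists, for the times `0, …, t`,
the ledgers it saw (`none` when it was offline).  Clients use only their views of the underlay
ledgers, and all the transactions that they output come from there. -/
structure Overlay (k : ℕ) where
  send : Fin k → List (Views k × List (Entry k)) → List (Fin k × Post k)
  output : List (Option (Views k)) → List ℕ
  output_valid : ∀ h, ∀ x ∈ output h, ∃ V : Views k, some V ∈ h ∧ ∃ i, Occurs x (V i)

/-- Those who observe the underlay ledgers: external clients, and the clients of all chains that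
are run by the validators of chain `i`. -/
inductive Observer (k : ℕ) : Type where
  | client (c : ℕ) : Observer k
  | validator (i : Fin k) (v : ℕ) : Observer k

/-- The data of a run of `k` underlay chains. -/
structure Run (k : ℕ) where
  /-- the honest validators of each chain -/
  honest : Fin k → Set ℕ
  /-- `online c t`: the client `c` is online at time `t` -/
  online : ℕ → ℕ → Prop
  /-- the ledgers output by an observer at a time -/
  view : Observer k → ℕ → Views k
  /-- `inbox i v t`: what is input to validator `v` of chain `i` at time `t`, by the environment,
  by the adversary or by honest validators of any chain -/
  inbox : Fin k → ℕ → ℕ → List (Entry k)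
  /-- the ledgers of each chain for which a certificate is ever broadcast -/
  certified : Fin k → Set (Ledger k)

namespace Run

variable {k : ℕ} (R : Run k)

/-- The observers whose views count at time `t`: online clients and honest validators. -/
def Active : Observer k → ℕ → Prop
  | .client c, t => R.online c t
  | .validator i v, _ => v ∈ R.honest i

/-- `e` has been input to all honest validators of chain `i` by time `t`. -/
def InputBy (i : Fin k) (e : Entry k) (t : ℕ) : Prop :=
  ∀ v ∈ R.honest i, ∃ s ≤ t, e ∈ R.inbox i v s

/-- Safety of an underlay chain. -/
def Safe (i : Fin k) : Prop :=
  (∀ o o' t t', R.Active o t → R.Active o' t' → Consistent (R.view o t i) (R.view o' t' i)) ∧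
  ∀ o t t', t ≤ t' → R.Active o t → R.Active o t' → R.view o t i <+: R.view o t' i

/-- Liveness of an underlay chain with latency `T`.  (Without honest validators, everything would
count as input to all of them, and no chain could be live.) -/
def Live (T : ℕ) (i : Fin k) : Prop :=
  (R.honest i).Nonempty ∧
  ∀ e t, R.InputBy i e t → ∀ o t', R.Active o t' → t + T ≤ t' →
    ∃ B ∈ R.view o t' i, e ∈ B.2

/-- The local history of validator `v` of chain `i` up to time `t`. -/
def validatorHistory (i : Fin k) (v t : ℕ) : List (Views k × List (Entry k)) :=
  (List.range (t + 1)).map fun s => (R.view (.validator i v) s, R.inbox i v s)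

open Classical in
/-- The local history of client `c` up to time `t`. -/
noncomputable def clientHistory (c t : ℕ) : List (Option (Views k)) :=
  (List.range (t + 1)).map fun s => if R.online c s then some (R.view (.client c) s) else none

/-- `R` is a run of the overlay protocol `P` under synchrony with network delay bound `Δ`, on
underlay chains with latency `T` that generate certificates and proceed in epochs. -/
structure IsExecution (P : Overlay k) (Δ T : ℕ) : Prop where
  /-- The posts of honest validators reach their honest recipients within `Δ`. -/
  delivery : ∀ i, ∀ v ∈ R.honest i, ∀ t j p, (j, p) ∈ P.send i (R.validatorHistory i v t) →
    ∀ v' ∈ R.honest j, ∃ s, t ≤ s ∧ s ≤ t + Δ ∧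
      p.entry (R.view (.validator i v) t) ∈ R.inbox j v' s
  /-- Finalized ledgers have certificates. -/
  view_certified : ∀ o t i, R.Active o t → R.view o t i ∈ R.certified i
  /-- Snapshots without a valid certificate are recognized and dropped: they are neither on
  ledgers nor among the inputs of honest validators. -/
  snapshot_certified : ∀ i, ∀ L ∈ R.certified i, ∀ B ∈ L, ∀ j L',
    Entry.snapshot j L' ∈ B.2 → L' ∈ R.certified j
  inbox_certified : ∀ i, ∀ v ∈ R.honest i, ∀ t j L',
    Entry.snapshot j L' ∈ R.inbox i v t → L' ∈ R.certified j
  /-- Timestamps increase strictly along a ledger. -/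
  timestamps : ∀ i, ∀ L ∈ R.certified i, L.Pairwise fun B B' => B.1 < B'.1
  /-- The chains generate certificates: if a chain is safe, then no conflicting ledgers of it are
  ever certified. -/
  certificates : ∀ i, R.Safe i → ∀ L ∈ R.certified i, ∀ L' ∈ R.certified i, Consistent L L'
  /-- The chains proceed in epochs: the timestamps of a live chain track the time.  No block is
  output before its timestamp; inputs are included in blocks with a timestamp within the
  latency; and new blocks keep being output. -/
  epochs : ∀ i, R.Live T i →
    (∀ o t, R.Active o t → ∀ B ∈ R.view o t i, B.1 ≤ t) ∧
    (∀ e t, R.InputBy i e t → ∀ o t', R.Active o t' → t + T ≤ t' →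
      ∃ B ∈ R.view o t' i, e ∈ B.2 ∧ B.1 ≤ t + T) ∧
    (∀ t o t', R.Active o t' → t + T ≤ t' → ∃ B ∈ R.view o t' i, t ≤ B.1)

/-- The overlay ledger of client `c` at time `t`. -/
noncomputable def overlayLedger (P : Overlay k) (c t : ℕ) : List ℕ :=
  P.output (R.clientHistory c t)

/-- Safety of the overlay protocol. -/
def OverlaySafe (P : Overlay k) : Prop :=
  (∀ c c' t t', R.online c t → R.online c' t' →
    Consistent (R.overlayLedger P c t) (R.overlayLedger P c' t')) ∧
  ∀ c t t', t ≤ t' → R.online c t → R.online c t' →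
    R.overlayLedger P c t <+: R.overlayLedger P c t'

/-- Liveness of the overlay protocol with latency `T'`; its validators are those of all the
underlay chains. -/
def OverlayLive (P : Overlay k) (T' : ℕ) : Prop :=
  ∀ x t, (∀ i, R.InputBy i (.tx x) t) → ∀ c t', R.online c t' → t + T' ≤ t' →
    x ∈ R.overlayLedger P c t'

end Run

/-- Pairs `(s, l)` of vectors in `{0,1}^k`, with the componentwise order: the chains that are
guaranteed to be safe, and those that are guaranteed to be live. -/
abbrev Guarantee (k : ℕ) : Type := (Fin k → Bool) × (Fin k → Bool)

/-- In the run `R`, the chains selected by `(s, l)` are safe, respectively live. -/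
def Run.Meets {k : ℕ} (R : Run k) (T : ℕ) (v : Guarantee k) : Prop :=
  (∀ i, v.1 i = true → R.Safe i) ∧ ∀ j, v.2 j = true → R.Live T j

/-- The set `V^S` of an overlay protocol under synchrony. -/
def Overlay.safetySet {k : ℕ} (P : Overlay k) (Δ T : ℕ) : Set (Guarantee k) :=
  {v | ∀ R : Run k, R.IsExecution P Δ T → R.Meets T v → R.OverlaySafe P}

/-- The set `V^L` of an overlay protocol under synchrony: liveness with a constant latency. -/
def Overlay.livenessSet {k : ℕ} (P : Overlay k) (Δ T : ℕ) : Set (Guarantee k) :=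
  {v | ∃ T' : ℕ, 0 < T' ∧
    ∀ R : Run k, R.IsExecution P Δ T → R.Meets T v → R.OverlayLive P T'}

/-- The extreme elements of `V`. -/
def exm {k : ℕ} (V : Set (Guarantee k)) : Set (Guarantee k) :=
  {v | v ∈ V ∧ ∀ w ∈ V, ¬ w < v}

/-- The set of guarantees that is described by a set `E` of extreme elements. -/
def generated {k : ℕ} (E : Set (Guarantee k)) : Set (Guarantee k) :=
  {w | ∃ v ∈ E, v ≤ w}

/-- The tuple `(E^S, E^L)` that characterizes an overlay protocol. -/
def Overlay.characterization {k : ℕ} (P : Overlay k) (Δ T : ℕ) :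
    Set (Guarantee k) × Set (Guarantee k) :=
  (exm (P.safetySet Δ T), exm (P.livenessSet Δ T))

/-- The tuple `p` dominates the tuple `q`. -/
def Dominates {k : ℕ} (p q : Set (Guarantee k) × Set (Guarantee k)) : Prop :=
  generated q.1 ⊆ generated p.1 ∧ generated q.2 ⊆ generated p.2

/-- `ind s`, the set of indices at which `s` is `1`. -/
def ind {k : ℕ} (s : Fin k → Bool) : Set (Fin k) := {i | s i = true}

/-! ### Merging lists of transactions -/

/-! Time is cut into attempts. Each is run by the chains `i` with `l i = true` for one element `(0,
l)` of `EL`, and all elements of `EL` recur in turn. In an attempt, its chains report their states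
at the start to its first chain, which proposes the latest reported earlier value extended by new
transactions. Snapshots of snapshots carry the proposal through all chains of the attempt; each of
them then records the outcome, and a client commits it once it sees all the records.

Safety. `hES` with `l₁ = l₂` gives each attempt a safe chain. Certified ledgers of a safe chain that
have passed a deadline have the same blocks up to it, so from this chain on the value is unique
(`relayed_unique`): later chains, even unsafe ones, can lose it but not change it. For two attempts,
`hES` lets the later one learn a value committed in the earlier one (`exists_known`): a common safe
chain reports its own record, or a safe and live chain of the earlier attempt posts its record, in
the spare last round, to a safe and live chain of the later one. A proposal needs reports of all
chains of its attempt, so it cannot miss the committed value, and inductively all later values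
extend it (`prefix_prepared`).

Liveness. A round is long enough for a live chain to pass a deadline and for its snapshot to get
onto the other live chains (`exists_snapshot`). So an attempt whose chains are all live commits
every transaction that was input early enough (`mem_overlayLedger`). No safety is needed here,
because conflicting values are merged instead of rejected; merging keeps all transactions and every
common prefix. -/

/-- The longer of two consistent lists, and the concatenation of inconsistent ones. -/
def join (u v : List ℕ) : List ℕ :=
  if u <+: v then v else if v <+: u then u else u ++ v

/-- The join of a list of lists: the longest of them if they are pairwise consistent. -/
def merge (l : List (List ℕ)) : List ℕ := l.foldr join []

theorem prefix_join (u v : List ℕ) : u <+: join u v := by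
  unfold join
  split_ifs with h h'
  · exact h
  · exact List.prefix_rfl
  · exact List.prefix_append u v

theorem mem_join {x : ℕ} {u v : List ℕ} : x ∈ join u v ↔ x ∈ u ∨ x ∈ v := by
  unfold join
  split_ifs with h h'
  · exact ⟨Or.inr, fun hx => hx.elim (fun hx => h.subset hx) id⟩
  · exact ⟨Or.inl, fun hx => hx.elim id (fun hx => h'.subset hx)⟩
  · exact List.mem_append

theorem mem_merge {x : ℕ} {l : List (List ℕ)} : x ∈ merge l ↔ ∃ v ∈ l, x ∈ v := by
  induction l with
  | nil => simp [merge]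
  | cons u l ih =>
    have : merge (u :: l) = join u (merge l) := rfl
    rw [this, mem_join, ih]
    simp

/-- Holds even for inconsistent lists, since `join` always extends its first argument. This keeps
committed values intact when unsafe chains supply conflicting extensions. -/
theorem prefix_merge {V : List ℕ} {l : List (List ℕ)} (hne : l ≠ []) (h : ∀ v ∈ l, V <+: v) :
    V <+: merge l := by
  cases l with
  | nil => exact absurd rfl hne
  | cons u l => exact (h u (by simp)).trans (prefix_join u (merge l))

theorem merge_of_consistent {l : List (List ℕ)} (h : ∀ u ∈ l, ∀ v ∈ l, Consistent u v) :
    (merge l = [] ∨ merge l ∈ l) ∧ ∀ v ∈ l, v <+: merge l := by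
  induction l with
  | nil => simp [merge]
  | cons u l ih =>
    obtain ⟨h1, h2⟩ := ih fun a ha b hb => h a (by simp [ha]) b (by simp [hb])
    have he : merge (u :: l) = join u (merge l) := rfl
    have hc : Consistent u (merge l) := by
      rcases h1 with h1 | h1
      · exact Or.inr (h1 ▸ List.nil_prefix)
      · exact h u (by simp) _ (by simp [h1])
    rw [he]
    unfold join
    split_ifs with h3 h4
    · refine ⟨h1.imp id (fun h => by simp [h]), fun v hv => ?_⟩
      rcases List.mem_cons.1 hv with rfl | hv
      · exact h3
      · exact h2 v hv
    · refine ⟨Or.inr (by simp), fun v hv => ?_⟩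
      rcases List.mem_cons.1 hv with rfl | hv
      · exact List.prefix_rfl
      · exact (h2 v hv).trans h4
    · exact absurd hc (not_or.2 ⟨h3, h4⟩)

theorem merge_eq_of_forall_eq {V : List ℕ} {l : List (List ℕ)} (hne : l ≠ [])
    (h : ∀ v ∈ l, v = V) : merge l = V := by
  have hc := merge_of_consistent (l := l) fun u hu v hv =>
    Or.inl (by rw [h u hu, h v hv])
  obtain ⟨u, hu⟩ := List.exists_mem_of_ne_nil l hne
  rcases hc.1 with h0 | h0
  · have := hc.2 u hu
    rw [h u hu, h0] at this
    rw [h0, List.prefix_nil.1 this]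
  · exact h _ h0

/-! ### Reading ledgers -/

section Ledgers

variable {k : ℕ}

/-- The snapshots of chain `j` on a ledger. -/
def snapshots (j : Fin k) (L : Ledger k) : List (Ledger k) :=
  L.flatMap fun B => B.2.filterMap fun e =>
    match e with
    | .snapshot i L' => if i = j then some L' else none
    | _ => none

/-- The transactions on a ledger, without those inside snapshots. -/
def transactions (L : Ledger k) : List ℕ :=
  L.flatMap fun B => B.2.filterMap fun e =>
    match e with
    | .tx x => some x
    | _ => none

/-- The blocks with timestamp at most `τ`. -/
def cut (τ : ℕ) (L : Ledger k) : Ledger k := L.filter fun B => B.1 ≤ τ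

/-- A ledger is closed at `τ` if it has a block with a later timestamp. -/
def ClosedAt (τ : ℕ) (L : Ledger k) : Prop := ∃ B ∈ L, τ < B.1

instance (τ : ℕ) (L : Ledger k) : Decidable (ClosedAt τ L) :=
  inferInstanceAs (Decidable (∃ B ∈ L, τ < B.1))

/-- The values that `g` assigns to the snapshots of chain `j` that are closed at `τ`. -/
def values (j : Fin k) (τ : ℕ) (g : Ledger k → Option (List ℕ)) (L : Ledger k) :
    List (List ℕ) :=
  ((snapshots j L).filter fun L' => ClosedAt τ L').filterMap g

/-! ### Membership in the data read off a ledger -/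

theorem mem_snapshots {j : Fin k} {L L' : Ledger k} :
    L' ∈ snapshots j L ↔ ∃ B ∈ L, Entry.snapshot j L' ∈ B.2 := by
  unfold snapshots
  simp only [List.mem_flatMap, List.mem_filterMap]
  refine exists_congr fun B => and_congr_right fun _ => ⟨?_, fun h => ⟨_, h, by simp⟩⟩
  rintro ⟨e, he, h⟩
  cases e with
  | tx x => simp at h
  | note m => simp at h
  | snapshot i L'' =>
    by_cases hij : i = j
    · simp only [hij, if_true, Option.some.injEq] at h
      subst hij h
      exact he
    · simp [hij] at h

theorem mem_transactions {x : ℕ} {L : Ledger k} :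
    x ∈ transactions L ↔ ∃ B ∈ L, Entry.tx x ∈ B.2 := by
  unfold transactions
  simp only [List.mem_flatMap, List.mem_filterMap]
  refine exists_congr fun B => and_congr_right fun _ => ⟨?_, fun h => ⟨_, h, by simp⟩⟩
  rintro ⟨e, he, h⟩
  cases e with
  | tx y =>
    simp only [Option.some.injEq] at h
    subst h
    exact he
  | note m => simp at h
  | snapshot i L'' => simp at h

theorem mem_cut {τ : ℕ} {L : Ledger k} {B : Block k} : B ∈ cut τ L ↔ B ∈ L ∧ B.1 ≤ τ := by
  simp [cut]

theorem mem_values {j : Fin k} {τ : ℕ} {g : Ledger k → Option (List ℕ)} {L : Ledger k}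
    {v : List ℕ} :
    v ∈ values j τ g L ↔
      ∃ L', (∃ B ∈ L, Entry.snapshot j L' ∈ B.2) ∧ ClosedAt τ L' ∧ g L' = some v := by
  simp [values, mem_snapshots, and_assoc]

theorem Occurs.of_cut {x τ : ℕ} {L : Ledger k} (h : Occurs x (cut τ L)) : Occurs x L := by
  cases h with
  | here hB hx => exact .here (mem_cut.1 hB).1 hx
  | nested hB hL hx => exact .nested (mem_cut.1 hB).1 hL hx

theorem occurs_of_mem_values {j : Fin k} {τ : ℕ} {g : Ledger k → Option (List ℕ)}
    (hg : ∀ L v, g L = some v → ∀ x ∈ v, Occurs x L) {L : Ledger k} {v : List ℕ}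
    (hv : v ∈ values j τ g L) {x : ℕ} (hx : x ∈ v) : Occurs x L := by
  obtain ⟨L', ⟨B, hB, hL'⟩, -, h⟩ := mem_values.1 hv
  exact .nested hB hL' (hg L' v h x hx)

/-- Timestamps increase, so a closed ledger can no longer acquire a block with timestamp at most
`τ`. Only `L'` has to be closed: a client may see a record on a ledger that is still open. -/
theorem mem_of_consistent_of_closedAt {L L' : Ledger k} {τ : ℕ} {B : Block k}
    (hc : Consistent L L') (hL : L.Pairwise fun B B' => B.1 < B'.1) (hcl : ClosedAt τ L')
    (hB : B ∈ L) (hτ : B.1 ≤ τ) : B ∈ L' := by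
  rcases hc with h | ⟨S, rfl⟩
  · exact h.subset hB
  · rcases List.mem_append.1 hB with h | h
    · exact h
    · obtain ⟨C, hC, hC'⟩ := hcl
      have := (List.pairwise_append.1 hL).2.2 C hC B h
      omega

theorem cut_append_of_closedAt {L S : Ledger k} {τ : ℕ}
    (hL : (L ++ S).Pairwise fun B B' => B.1 < B'.1) (hcl : ClosedAt τ L) :
    cut τ (L ++ S) = cut τ L := by
  have : cut τ S = [] := by
    refine List.eq_nil_iff_forall_not_mem.2 fun B hB => ?_
    obtain ⟨C, hC, hC'⟩ := hcl
    have := (List.pairwise_append.1 hL).2.2 C hC B (mem_cut.1 hB).1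
    have := (mem_cut.1 hB).2
    omega
  unfold cut at *
  rw [List.filter_append, this, List.append_nil]

/-- The source of agreement: a rule that reads only `cut τ` gives one answer on all closed certified
ledgers of a safe chain. -/
theorem cut_eq_of_consistent {L L' : Ledger k} {τ : ℕ} (hc : Consistent L L')
    (hL : L.Pairwise fun B B' => B.1 < B'.1) (hL' : L'.Pairwise fun B B' => B.1 < B'.1)
    (hcl : ClosedAt τ L) (hcl' : ClosedAt τ L') : cut τ L = cut τ L' := by
  rcases hc with ⟨S, rfl⟩ | ⟨S, rfl⟩
  · exact (cut_append_of_closedAt hL' hcl).symm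
  · exact cut_append_of_closedAt hL hcl'

end Ledgers

/-! ### The protocol -/

/-- A schedule: a sequence of attempts to extend the overlay ledger.  Attempt `w` is made by the
chains `chain w 0, …, chain w last` and takes `last + 3` rounds of length `round`. -/
structure Schedule (k : ℕ) where
  last : ℕ
  round : ℕ
  chain : ℕ → ℕ → Fin k

namespace Schedule

variable {k : ℕ} (S : Schedule k)

/-- The end of round `q` of attempt `w`, counted from the end of the previous attempt. -/
def time (w q : ℕ) : ℕ := (w * (S.last + 3) + q) * S.round

/-- The values of attempt `m` that the owner of the ledger `L` knows, directly or by a snapshot of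
some other chain. -/
def known (g : Ledger k → Option (List ℕ)) (m : ℕ) (L : Ledger k) : List (List ℕ) :=
  values (S.chain m S.last) (S.time m (S.last + 1)) g L ++
    (List.finRange k).flatMap fun j =>
      (snapshots j L).flatMap (values (S.chain m S.last) (S.time m (S.last + 1)) g)

/-- The states of chain `j` at the start of attempt `w` that are reported on `C`. -/
def reports (w : ℕ) (C : Ledger k) (j : Fin k) : List (Ledger k) :=
  (snapshots j C).filter fun L => ClosedAt (S.time w 0) L

/-- The values of attempt `m` that are reported to attempt `w`. -/
def reported (g : Ledger k → Option (List ℕ)) (w m : ℕ) (C : Ledger k) : List (List ℕ) :=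
  (List.range (S.last + 1)).flatMap fun q =>
    (S.reports w C (S.chain w q)).flatMap (S.known g m)

/-- The value of the latest attempt before `m` of which a value is reported to attempt `w`. -/
def latest (f : ℕ → Ledger k → Option (List ℕ)) (w : ℕ) (C : Ledger k) : ℕ → List ℕ
  | 0 => []
  | m + 1 => if S.reported (f m) w m C = [] then latest f w C m
      else merge (S.reported (f m) w m C)

/-- The proposal of attempt `w`, once all of its chains have reported their states: the latest
reported value, extended by new transactions. -/
def proposal (f : ℕ → Ledger k → Option (List ℕ)) (w : ℕ) (C : Ledger k) : Option (List ℕ) :=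
  if ∀ q < S.last + 1, S.reports w C (S.chain w q) ≠ [] then
    some (S.latest f w C w ++ (transactions C).filter (· ∉ S.latest f w C w))
  else none

/-- The value of attempt `w` after it has passed through the chains `chain w 0, …, chain w q`,
as a function of the ledger of the last one of them. -/
def relayed (f : ℕ → Ledger k → Option (List ℕ)) (w : ℕ) : ℕ → Ledger k → Option (List ℕ)
  | 0, L => S.proposal f w (cut (S.time w 1) L)
  | q + 1, L =>
    let l := values (S.chain w q) (S.time w (q + 1)) (relayed f w q) (cut (S.time w (q + 2)) L)
    if l = [] then none else some (merge l)

/-- The value of attempt `w`, as a function of the ledger of chain `chain w last`. -/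
def prepared (w : ℕ) (L : Ledger k) : Option (List ℕ) :=
  S.relayed (fun m L' => if _h : m < w then prepared m L' else none) w S.last L
termination_by w

/-- The values of attempts before `w`. -/
def earlier (w m : ℕ) (L : Ledger k) : Option (List ℕ) := if m < w then S.prepared m L else none

/-- The values of attempt `w` that the chain with ledger `L` has recorded. -/
def recorded (w : ℕ) (L : Ledger k) : List (List ℕ) :=
  values (S.chain w S.last) (S.time w (S.last + 1)) (S.prepared w) (cut (S.time w (S.last + 2)) L)

/-- The values that all chains of attempt `w` have recorded. -/
def committed (w : ℕ) (V : Views k) : List (List ℕ) :=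
  if ∀ q < S.last + 1, S.recorded w (V (S.chain w q)) ≠ [] then
    (List.range (S.last + 1)).flatMap fun q => S.recorded w (V (S.chain w q))
  else []

/-- All the values that a client has seen committed. -/
def allCommitted (h : List (Option (Views k))) : List (List ℕ) :=
  h.reduceOption.flatMap fun V => (List.range h.length).flatMap fun w => S.committed w V

/-! ### Unfolding the recursion and the collected lists -/

theorem prepared_eq (w : ℕ) (L : Ledger k) :
    S.prepared w L = S.relayed (S.earlier w) w S.last L := by
  rw [prepared]
  congr 1

theorem relayed_succ_eq_some {f : ℕ → Ledger k → Option (List ℕ)} {w q : ℕ} {L : Ledger k}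
    {v : List ℕ} : S.relayed f w (q + 1) L = some v ↔
      values (S.chain w q) (S.time w (q + 1)) (S.relayed f w q) (cut (S.time w (q + 2)) L) ≠ [] ∧
      merge (values (S.chain w q) (S.time w (q + 1)) (S.relayed f w q)
        (cut (S.time w (q + 2)) L)) = v := by
  rw [relayed]
  simp

theorem mem_reports {w : ℕ} {C L : Ledger k} {j : Fin k} :
    L ∈ S.reports w C j ↔ (∃ B ∈ C, Entry.snapshot j L ∈ B.2) ∧ ClosedAt (S.time w 0) L := by
  simp [reports, mem_snapshots]

theorem mem_known {g : Ledger k → Option (List ℕ)} {m : ℕ} {L : Ledger k} {v : List ℕ} :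
    v ∈ S.known g m L ↔
      v ∈ values (S.chain m S.last) (S.time m (S.last + 1)) g L ∨
      ∃ j L', (∃ B ∈ L, Entry.snapshot j L' ∈ B.2) ∧
        v ∈ values (S.chain m S.last) (S.time m (S.last + 1)) g L' := by
  simp [known, mem_snapshots]

theorem mem_reported {g : Ledger k → Option (List ℕ)} {w m : ℕ} {C : Ledger k} {v : List ℕ} :
    v ∈ S.reported g w m C ↔
      ∃ q < S.last + 1, ∃ L ∈ S.reports w C (S.chain w q), v ∈ S.known g m L := by
  simp [reported]

/-- The latest reported value is empty or the merge of reported values of one attempt. -/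
theorem latest_spec (f : ℕ → Ledger k → Option (List ℕ)) (w : ℕ) (C : Ledger k) (n : ℕ) :
    (S.latest f w C n = [] ∧ ∀ m < n, S.reported (f m) w m C = []) ∨
    ∃ m < n, S.reported (f m) w m C ≠ [] ∧
      S.latest f w C n = merge (S.reported (f m) w m C) ∧
      ∀ m' < n, m < m' → S.reported (f m') w m' C = [] := by
  induction n with
  | zero => exact Or.inl ⟨rfl, by simp⟩
  | succ n ih =>
    by_cases h : S.reported (f n) w n C = []
    · have he : S.latest f w C (n + 1) = S.latest f w C n := by rw [latest, if_pos h]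
      rcases ih with ⟨h1, h2⟩ | ⟨m, h1, h2, h3, h4⟩
      · refine Or.inl ⟨he.trans h1, fun m hm => ?_⟩
        rcases Nat.lt_succ_iff_lt_or_eq.1 hm with hm | rfl
        exacts [h2 m hm, h]
      · refine Or.inr ⟨m, by omega, h2, he.trans h3, fun m' hm hm' => ?_⟩
        rcases Nat.lt_succ_iff_lt_or_eq.1 hm with hm | rfl
        exacts [h4 m' hm hm', h]
    · exact Or.inr ⟨n, by omega, h, by rw [latest, if_neg h], fun m' _ _ => by omega⟩

/-! ### Transactions come from the ledgers -/

theorem occurs_of_mem_known {g : Ledger k → Option (List ℕ)}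
    (hg : ∀ L v, g L = some v → ∀ x ∈ v, Occurs x L) {m : ℕ} {L : Ledger k} {v : List ℕ}
    (hv : v ∈ S.known g m L) {x : ℕ} (hx : x ∈ v) : Occurs x L := by
  rcases S.mem_known.1 hv with h | ⟨j, L', ⟨B, hB, hL'⟩, h⟩
  · exact occurs_of_mem_values hg h hx
  · exact .nested hB hL' (occurs_of_mem_values hg h hx)

theorem occurs_of_mem_relayed {f : ℕ → Ledger k → Option (List ℕ)}
    (hf : ∀ m L v, f m L = some v → ∀ x ∈ v, Occurs x L) (w q : ℕ) :
    ∀ L v, S.relayed f w q L = some v → ∀ x ∈ v, Occurs x L := by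
  induction q with
  | zero =>
    intro L v h x hx
    rw [relayed, proposal] at h
    split_ifs at h with hr
    obtain rfl := Option.some.inj h
    refine Occurs.of_cut (τ := S.time w 1) ?_
    rcases List.mem_append.1 hx with hx | hx
    · rcases S.latest_spec f w (cut (S.time w 1) L) w with ⟨h1, -⟩ | ⟨m, -, -, h1, -⟩
      · rw [h1] at hx
        simp at hx
      · rw [h1] at hx
        obtain ⟨v, hv, hx⟩ := mem_merge.1 hx
        obtain ⟨q, -, L', hL', hv⟩ := S.mem_reported.1 hv
        obtain ⟨⟨B, hB, hB'⟩, -⟩ := S.mem_reports.1 hL'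
        exact .nested hB hB' (S.occurs_of_mem_known (hf m) hv hx)
    · obtain ⟨B, hB, hx⟩ := mem_transactions.1 (List.mem_filter.1 hx).1
      exact .here hB hx
  | succ q ih =>
    intro L v h x hx
    obtain ⟨-, rfl⟩ := S.relayed_succ_eq_some.1 h
    obtain ⟨v, hv, hx⟩ := mem_merge.1 hx
    exact (occurs_of_mem_values ih hv hx).of_cut

theorem occurs_of_mem_prepared (w : ℕ) :
    ∀ L v, S.prepared w L = some v → ∀ x ∈ v, Occurs x L := by
  induction w using Nat.strong_induction_on with
  | _ w ih =>
    intro L v h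
    rw [prepared_eq] at h
    refine S.occurs_of_mem_relayed (fun m L v hv => ?_) w S.last L v h
    unfold earlier at hv
    split_ifs at hv with hm
    exact ih m hm L v hv

theorem mem_committed {w : ℕ} {V : Views k} {v : List ℕ} :
    v ∈ S.committed w V ↔ (∀ q < S.last + 1, S.recorded w (V (S.chain w q)) ≠ []) ∧
      ∃ q < S.last + 1, v ∈ S.recorded w (V (S.chain w q)) := by
  unfold committed
  split_ifs with h
  · simp only [List.mem_flatMap, List.mem_range]
    exact ⟨fun h' => ⟨h, h'⟩, fun h' => h'.2⟩
  · simp only [List.not_mem_nil, false_iff]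
    exact fun h' => h h'.1

theorem mem_allCommitted {h : List (Option (Views k))} {v : List ℕ} :
    v ∈ S.allCommitted h ↔ ∃ V, some V ∈ h ∧ ∃ w < h.length, v ∈ S.committed w V := by
  simp [allCommitted, List.reduceOption_mem_iff]

/-- The overlay protocol of a schedule: the honest validators keep posting all that they see to
all chains, and the clients output the values that they have seen committed. -/
def overlay : Overlay k where
  send _ _ := (List.finRange k).flatMap fun j => (List.finRange k).map fun i => (j, .snapshot i)
  output h := merge (S.allCommitted h)
  output_valid h x hx := by
    obtain ⟨v, hv, hx⟩ := mem_merge.1 hx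
    obtain ⟨V, hV, w, -, hv⟩ := S.mem_allCommitted.1 hv
    obtain ⟨-, q, -, hv⟩ := S.mem_committed.1 hv
    exact ⟨V, hV, S.chain w q,
      (occurs_of_mem_values (S.occurs_of_mem_prepared w) hv hx).of_cut⟩

theorem mem_send (i : Fin k) (h : List (Views k × List (Entry k))) (j i' : Fin k) :
    (j, Post.snapshot i') ∈ S.overlay.send i h := by
  simp [overlay]

/-! ### Arithmetic of the round times -/

theorem time_add_round (w q : ℕ) : S.time w q + S.round = S.time w (q + 1) := by
  unfold time
  ring

theorem time_succ (w : ℕ) : S.time (w + 1) 0 = S.time w (S.last + 3) := by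
  unfold time
  ring

theorem time_le {w w' : ℕ} (h : w ≤ w') : S.time w 0 ≤ S.time w' 0 := by
  unfold time
  gcongr

end Schedule

/-! ### Executions -/

section Execution

variable {k Δ T : ℕ} {S : Schedule k} {R : Run k}

namespace Run

theorem IsExecution.consistent {P : Overlay k} (hR : R.IsExecution P Δ T) {i : Fin k}
    (hs : R.Safe i) {L L' : Ledger k} (hL : L ∈ R.certified i) (hL' : L' ∈ R.certified i) :
    Consistent L L' :=
  hR.certificates i hs L hL L' hL'

theorem IsExecution.mem_of_closedAt {P : Overlay k} (hR : R.IsExecution P Δ T) {i : Fin k}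
    (hs : R.Safe i) {L L' : Ledger k} (hL : L ∈ R.certified i) (hL' : L' ∈ R.certified i)
    {τ : ℕ} (hcl : ClosedAt τ L') {B : Block k} (hB : B ∈ L) (hτ : B.1 ≤ τ) : B ∈ L' :=
  mem_of_consistent_of_closedAt (hR.consistent hs hL hL') (hR.timestamps i L hL) hcl hB hτ

/-- A live chain has a certified ledger that is closed at `σ`, a snapshot of which is on all other
live chains by the end of the next round. -/
theorem IsExecution.exists_snapshot (hR : R.IsExecution S.overlay Δ T)
    (hS : S.round = 2 * T + Δ + 1) {i : Fin k} (hi : R.Live T i) (σ : ℕ) :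
    ∃ v ∈ R.honest i, ClosedAt σ (R.view (.validator i v) (σ + 1 + T) i) ∧
      ∀ j, R.Live T j → ∀ o t, R.Active o t → σ + S.round ≤ t →
        ∃ B ∈ R.view o t j, B.1 ≤ σ + S.round ∧
          Entry.snapshot i (R.view (.validator i v) (σ + 1 + T) i) ∈ B.2 := by
  obtain ⟨v, hv⟩ := hi.1
  refine ⟨v, hv, ?_, fun j hj o t ho ht => ?_⟩
  · obtain ⟨B, hB, h⟩ := (hR.epochs i hi).2.2 (σ + 1) (.validator i v) (σ + 1 + T) hv le_rfl
    exact ⟨B, hB, h⟩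
  · have hin : R.InputBy j (Entry.snapshot i (R.view (.validator i v) (σ + 1 + T) i))
        (σ + 1 + T + Δ) := by
      intro v' hv'
      obtain ⟨s, -, hs, h⟩ := hR.delivery i v hv (σ + 1 + T) j (.snapshot i)
        (S.mem_send _ _ _ _) v' hv'
      exact ⟨s, hs, h⟩
    obtain ⟨B, hB, he, hτ⟩ := (hR.epochs j hj).2.1 _ _ hin o t ho (by omega)
    exact ⟨B, hB, by omega, he⟩

/-! ### Safety -/

/-- Any two attempts share a safe chain, or each of them has a chain that is safe and live. -/
def Linked (R : Run k) (T : ℕ) (S : Schedule k) : Prop :=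
  ∀ w w',
    (∃ q < S.last + 1, ∃ q' < S.last + 1,
      (R.Safe (S.chain w q) ∧ R.Live T (S.chain w q)) ∧
      (R.Safe (S.chain w' q') ∧ R.Live T (S.chain w' q'))) ∨
    ∃ q < S.last + 1, ∃ q' < S.last + 1, S.chain w q = S.chain w' q' ∧ R.Safe (S.chain w q)

/-- At the safe chain `q₀` the value depends only on the cut at the deadline, which all closed
certified ledgers share. Every later chain merges copies of this single value, or yields none. -/
theorem IsExecution.relayed_unique {P : Overlay k} (hR : R.IsExecution P Δ T)
    (f : ℕ → Ledger k → Option (List ℕ)) {w q₀ : ℕ} (hs : R.Safe (S.chain w q₀)) (n : ℕ) :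
    ∃ V, ∀ L ∈ R.certified (S.chain w (q₀ + n)), ClosedAt (S.time w (q₀ + n + 1)) L →
      ∀ v, S.relayed f w (q₀ + n) L = some v → v = V := by
  induction n with
  | zero =>
    by_cases h : ∃ L ∈ R.certified (S.chain w q₀), ClosedAt (S.time w (q₀ + 1)) L ∧
        ∃ V, S.relayed f w q₀ L = some V
    · obtain ⟨L, hL, hc, V, hV⟩ := h
      refine ⟨V, fun L' hL' hc' v hv => ?_⟩
      have hcut := cut_eq_of_consistent (hR.consistent hs hL hL')
        (hR.timestamps _ L hL) (hR.timestamps _ L' hL') hc hc'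
      have : S.relayed f w q₀ L = S.relayed f w q₀ L' := by
        cases q₀ with
        | zero => rw [Schedule.relayed, Schedule.relayed, hcut]
        | succ q => rw [Schedule.relayed, Schedule.relayed, hcut]
      rw [hV] at this
      exact (Option.some.inj (this.trans hv)).symm
    -- No closed certified ledger carries a value, so the choice of `V` is arbitrary.
    · exact ⟨[], fun L hL hc v hv => absurd ⟨L, hL, hc, v, hv⟩ h⟩
  | succ n ih =>
    obtain ⟨V, hV⟩ := ih
    refine ⟨V, fun L hL _ v hv => ?_⟩
    obtain ⟨hne, rfl⟩ := S.relayed_succ_eq_some.1 hv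
    refine merge_eq_of_forall_eq hne fun u hu => ?_
    obtain ⟨L', ⟨B, hB, he⟩, hc, hu⟩ := mem_values.1 hu
    exact hV L' (hR.snapshot_certified _ L hL B (mem_cut.1 hB).1 _ L' he) hc u hu

theorem IsExecution.prepared_unique {P : Overlay k} (hR : R.IsExecution P Δ T)
    (hlink : R.Linked T S) (w : ℕ) :
    ∃ V, ∀ L ∈ R.certified (S.chain w S.last), ClosedAt (S.time w (S.last + 1)) L →
      ∀ v, S.prepared w L = some v → v = V := by
  obtain ⟨q, hq, hs⟩ : ∃ q < S.last + 1, R.Safe (S.chain w q) := by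
    -- Linking an attempt to itself provides a safe chain in either case.
    rcases hlink w w with ⟨q, hq, -, -, h, -⟩ | ⟨q, hq, -, -, -, h⟩
    exacts [⟨q, hq, h.1⟩, ⟨q, hq, h⟩]
  have := hR.relayed_unique (S.earlier w) hs (S.last - q)
  rw [Nat.add_sub_cancel' (by omega)] at this
  simpa only [Schedule.prepared_eq] using this

theorem IsExecution.of_mem_values {P : Overlay k} (hR : R.IsExecution P Δ T)
    {i j : Fin k} {τ : ℕ} {g : Ledger k → Option (List ℕ)} {L : Ledger k}
    (hL : L ∈ R.certified i) {v : List ℕ} (hv : v ∈ values j τ g L) :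
    ∃ L' ∈ R.certified j, ClosedAt τ L' ∧ g L' = some v := by
  obtain ⟨L', ⟨B, hB, he⟩, hc, hg⟩ := mem_values.1 hv
  exact ⟨L', hR.snapshot_certified i L hL B hB j L' he, hc, hg⟩

theorem IsExecution.of_mem_recorded {P : Overlay k} (hR : R.IsExecution P Δ T)
    {i : Fin k} {w : ℕ} {L : Ledger k} (hL : L ∈ R.certified i) {v : List ℕ}
    (hv : v ∈ S.recorded w L) :
    ∃ L' ∈ R.certified (S.chain w S.last), ClosedAt (S.time w (S.last + 1)) L' ∧
      S.prepared w L' = some v := by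
  obtain ⟨L', ⟨B, hB, he⟩, hc, hg⟩ := mem_values.1 hv
  exact ⟨L', hR.snapshot_certified i L hL B (mem_cut.1 hB).1 _ L' he, hc, hg⟩

theorem IsExecution.of_mem_reported {P : Overlay k} (hR : R.IsExecution P Δ T)
    {i : Fin k} {w m : ℕ} {g : Ledger k → Option (List ℕ)} {L : Ledger k}
    (hL : L ∈ R.certified i) {τ : ℕ} {v : List ℕ} (hv : v ∈ S.reported g w m (cut τ L)) :
    ∃ L' ∈ R.certified (S.chain m S.last), ClosedAt (S.time m (S.last + 1)) L' ∧
      g L' = some v := by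
  obtain ⟨q, -, L', hL', hv⟩ := S.mem_reported.1 hv
  obtain ⟨⟨B, hB, he⟩, -⟩ := S.mem_reports.1 hL'
  have hc := hR.snapshot_certified i L hL B (mem_cut.1 hB).1 _ L' he
  rcases S.mem_known.1 hv with h | ⟨j, L'', ⟨B, hB, he⟩, h⟩
  · exact hR.of_mem_values hc h
  · exact hR.of_mem_values (hR.snapshot_certified _ L' hc B hB j L'' he) h

/-! ### Persistence of committed values -/

/-- If all chains of attempt `w` have recorded its value, then one of the chains of any later
attempt knows it. -/
theorem IsExecution.exists_known (hR : R.IsExecution S.overlay Δ T)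
    (hS : S.round = 2 * T + Δ + 1) (hlink : R.Linked T S) {w w' : ℕ} (hw : w < w')
    {V : Views k} (hV : ∀ i, V i ∈ R.certified i)
    (hrec : ∀ q < S.last + 1, S.recorded w (V (S.chain w q)) ≠ []) :
    ∃ q < S.last + 1, ∀ L ∈ R.certified (S.chain w' q), ClosedAt (S.time w' 0) L →
      S.known (S.prepared w) w L ≠ [] := by
  -- One spare round, the last of the `last + 3`, separates the recording deadline from the next
  -- attempt; it is there to spread the records.
  have ht : S.time w (S.last + 2) + S.round ≤ S.time w' 0 := by
    rw [S.time_add_round, ← S.time_succ]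
    exact S.time_le hw
  rcases hlink w w' with ⟨q, hq, q', hq', ⟨hs, hl⟩, hs', hl'⟩ | ⟨q, hq, q', hq', he, hs⟩
  · refine ⟨q', hq', fun L hL hc => ?_⟩
    obtain ⟨v, hv⟩ := List.exists_mem_of_ne_nil _ (hrec q hq)
    obtain ⟨L₁, ⟨B, hB, hB'⟩, hv⟩ := mem_values.1 hv
    obtain ⟨a, ha, hcl, hpost⟩ := hR.exists_snapshot hS hl (S.time w (S.last + 2))
    have hcert := hR.view_certified (.validator _ a) (S.time w (S.last + 2) + 1 + T)
      (S.chain w q) ha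
    -- The validator's snapshot is closed at the recording deadline and its chain is safe, so it
    -- contains the record seen in `V`.
    have hBU := hR.mem_of_closedAt hs (hV _) hcert hcl (mem_cut.1 hB).1 (mem_cut.1 hB).2
    obtain ⟨b, hb⟩ := hl'.1
    obtain ⟨C, hC, hCt, hC'⟩ := hpost _ hl' (.validator _ b)
      (S.time w (S.last + 2) + S.round) hb le_rfl
    -- That snapshot is on the later attempt's chain before this attempt starts, so every state of
    -- this safe chain closed at the start contains it. This is why `known` looks one snapshot
    -- deeper.
    have hCL := hR.mem_of_closedAt hs' (hR.view_certified (.validator _ b) _ _ hb) hL hc hC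
      (hCt.trans ht)
    exact List.ne_nil_of_mem
      (S.mem_known.2 (Or.inr ⟨_, _, ⟨C, hCL, hC'⟩, mem_values.2 ⟨L₁, ⟨B, hBU, hB'⟩, hv⟩⟩))
  · refine ⟨q', hq', fun L hL hc => ?_⟩
    rw [← he] at hL
    obtain ⟨v, hv⟩ := List.exists_mem_of_ne_nil _ (hrec q hq)
    obtain ⟨L₁, ⟨B, hB, hB'⟩, hv⟩ := mem_values.1 hv
    have hBL := hR.mem_of_closedAt hs (hV _) hL hc (mem_cut.1 hB).1
      ((mem_cut.1 hB).2.trans (by omega))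
    exact List.ne_nil_of_mem
      (S.mem_known.2 (Or.inl (mem_values.2 ⟨L₁, ⟨B, hBL, hB'⟩, hv⟩)))

/-- The values of later attempts extend a committed value. -/
theorem IsExecution.prefix_prepared (hR : R.IsExecution S.overlay Δ T)
    (hS : S.round = 2 * T + Δ + 1) (hlink : R.Linked T S) {w : ℕ}
    {V : Views k} (hV : ∀ i, V i ∈ R.certified i) {u : List ℕ} (hu : u ∈ S.committed w V)
    (w' : ℕ) (hw : w ≤ w') :
    ∀ L ∈ R.certified (S.chain w' S.last), ClosedAt (S.time w' (S.last + 1)) L →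
      ∀ v, S.prepared w' L = some v → u <+: v := by
  obtain ⟨hrec, q₁, hq₁, hu⟩ := S.mem_committed.1 hu
  obtain ⟨L₁, hL₁, hc₁, hu⟩ := hR.of_mem_recorded (hV _) hu
  induction w' using Nat.strong_induction_on with
  | _ w' ih =>
    rcases hw.eq_or_lt with rfl | hw
    · intro L hL hc v hv
      obtain ⟨V₀, hV₀⟩ := hR.prepared_unique hlink w
      rw [hV₀ L hL hc v hv, hV₀ L₁ hL₁ hc₁ u hu]
    -- No chain of attempt `w'` is assumed safe here: every proposal on a certified ledger already
    -- extends `u`, and relaying preserves this.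
    · have key : ∀ q, ∀ L ∈ R.certified (S.chain w' q), ∀ v,
          S.relayed (S.earlier w') w' q L = some v → u <+: v := by
        intro q
        induction q with
        | zero =>
          intro L hL v hv
          rw [Schedule.relayed, Schedule.proposal] at hv
          split_ifs at hv with hr
          obtain rfl := Option.some.inj hv
          refine List.IsPrefix.trans ?_ (List.prefix_append _ _)
          obtain ⟨q, hq, hk⟩ := hR.exists_known hS hlink hw hV hrec
          obtain ⟨L', hL'⟩ := List.exists_mem_of_ne_nil _ (hr q hq)
          obtain ⟨⟨B, hB, he⟩, hcl⟩ := S.mem_reports.1 hL'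
          have hknown := hk L'
            (hR.snapshot_certified _ L hL B (mem_cut.1 hB).1 _ L' he) hcl
          obtain ⟨v, hv⟩ := List.exists_mem_of_ne_nil _ hknown
          have hne : S.reported (S.earlier w' w) w' w (cut (S.time w' 1) L) ≠ [] := by
            refine List.ne_nil_of_mem (S.mem_reported.2 ⟨q, hq, L', hL', (?_ : v ∈ _)⟩)
            have : S.earlier w' w = S.prepared w := by
              funext L
              exact if_pos hw
            rwa [this]
          rcases S.latest_spec (S.earlier w') w' (cut (S.time w' 1) L) w' with
            ⟨-, h⟩ | ⟨m, hm, hmne, heq, h⟩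
          · exact absurd (h w hw) hne
          · have hwm : w ≤ m := by
              by_contra hlt
              exact hne (h w hw (by omega))
            rw [heq]
            refine prefix_merge hmne fun v hv => ?_
            obtain ⟨L₂, hL₂, hc₂, hv⟩ := hR.of_mem_reported hL hv
            rw [Schedule.earlier, if_pos hm] at hv
            exact ih m hm hwm L₂ hL₂ hc₂ v hv
        | succ q ihq =>
          intro L hL v hv
          obtain ⟨hne, rfl⟩ := S.relayed_succ_eq_some.1 hv
          refine prefix_merge hne fun v hv => ?_
          obtain ⟨L', ⟨B, hB, he⟩, -, hv⟩ := mem_values.1 hv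
          exact ihq L' (hR.snapshot_certified _ L hL B (mem_cut.1 hB).1 _ L' he) v hv
      intro L hL _ v hv
      rw [Schedule.prepared_eq] at hv
      exact key S.last L hL v hv

/-! ### Safety of the client outputs -/

theorem IsExecution.consistent_committed (hR : R.IsExecution S.overlay Δ T)
    (hS : S.round = 2 * T + Δ + 1) (hlink : R.Linked T S) {w w' : ℕ}
    {V V' : Views k} (hV : ∀ i, V i ∈ R.certified i) (hV' : ∀ i, V' i ∈ R.certified i)
    {u u' : List ℕ} (hu : u ∈ S.committed w V) (hu' : u' ∈ S.committed w' V') :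
    Consistent u u' := by
  wlog hw : w ≤ w' generalizing w w' V V' u u'
  · exact (this hV' hV hu' hu (by omega)).symm
  obtain ⟨-, q, -, h⟩ := S.mem_committed.1 hu'
  obtain ⟨L, hL, hc, h⟩ := hR.of_mem_recorded (hV' _) h
  exact Or.inl (hR.prefix_prepared hS hlink hV hu w' hw L hL hc u' h)

theorem some_mem_clientHistory {c t : ℕ} {V : Views k} :
    some V ∈ R.clientHistory c t ↔ ∃ s ≤ t, R.online c s ∧ R.view (.client c) s = V := by
  unfold clientHistory
  simp only [List.mem_map, List.mem_range, Nat.lt_succ_iff]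
  refine exists_congr fun s => and_congr_right fun _ => ?_
  split_ifs with h <;> simp [h]

theorem length_clientHistory (c t : ℕ) : (R.clientHistory c t).length = t + 1 := by
  simp [clientHistory]

theorem IsExecution.overlaySafe (hR : R.IsExecution S.overlay Δ T)
    (hS : S.round = 2 * T + Δ + 1) (hlink : R.Linked T S) : R.OverlaySafe S.overlay := by
  have hcons : ∀ c c' t t', ∀ u ∈ S.allCommitted (R.clientHistory c t),
      ∀ v ∈ S.allCommitted (R.clientHistory c' t'), Consistent u v := by
    intro c c' t t' u hu v hv
    obtain ⟨V, hV, w, -, hu⟩ := S.mem_allCommitted.1 hu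
    obtain ⟨V', hV', w', -, hv⟩ := S.mem_allCommitted.1 hv
    obtain ⟨s, -, hs, rfl⟩ := some_mem_clientHistory.1 hV
    obtain ⟨s', -, hs', rfl⟩ := some_mem_clientHistory.1 hV'
    exact hR.consistent_committed hS hlink (fun i => hR.view_certified (.client c) s i hs)
      (fun i => hR.view_certified (.client c') s' i hs') hu hv
  have hmerge := fun c t => merge_of_consistent (hcons c c t t)
  refine ⟨fun c c' t t' _ _ => ?_, fun c t t' htt' _ _ => ?_⟩
  · change Consistent (merge _) (merge _)
    rcases (hmerge c t).1 with h | h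
    · exact Or.inl (h ▸ List.nil_prefix)
    rcases (hmerge c' t').1 with h' | h'
    · exact Or.inr (h' ▸ List.nil_prefix)
    exact hcons c c' t t' _ h _ h'
  · change merge _ <+: merge _
    rcases (hmerge c t).1 with h | h
    · exact h ▸ List.nil_prefix
    refine (hmerge c t').2 _ ?_
    -- The merge at time `t` is itself a committed value, and the longer history up to `t'` still
    -- contains it.
    obtain ⟨V, hV, w, hw, hu⟩ := S.mem_allCommitted.1 h
    obtain ⟨s, hs, hon, rfl⟩ := some_mem_clientHistory.1 hV
    rw [length_clientHistory] at hw
    exact S.mem_allCommitted.2 ⟨_, some_mem_clientHistory.2 ⟨s, hs.trans htt', hon, rfl⟩, w,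
      by rw [length_clientHistory]; omega, hu⟩

/-! ### Liveness -/

/-- One hop between live chains: a value carried by `i` after the deadline of step `q` is readable
on `j` one round later. -/
theorem IsExecution.exists_mem_values (hR : R.IsExecution S.overlay Δ T)
    (hS : S.round = 2 * T + Δ + 1) {i j : Fin k} (hi : R.Live T i) (hj : R.Live T j)
    {x w q : ℕ} {g : Ledger k → Option (List ℕ)}
    (hg : ∀ o t, R.Active o t → S.time w q ≤ t → ∃ v, g (R.view o t i) = some v ∧ x ∈ v)
    {o : Observer k} {t : ℕ} (ho : R.Active o t) (ht : S.time w (q + 1) ≤ t) :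
    ∃ v ∈ values i (S.time w q) g (cut (S.time w (q + 1)) (R.view o t j)), x ∈ v := by
  rw [← S.time_add_round] at ht ⊢
  obtain ⟨a, ha, hcl, hpost⟩ := hR.exists_snapshot hS hi (S.time w q)
  obtain ⟨B, hB, hBt, he⟩ := hpost j hj o t ho ht
  obtain ⟨v, hv, hx⟩ := hg (.validator i a) (S.time w q + 1 + T) ha (by omega)
  exact ⟨v, mem_values.2 ⟨_, ⟨B, mem_cut.2 ⟨hB, hBt⟩, he⟩, hcl, hv⟩, hx⟩

theorem IsExecution.exists_relayed (hR : R.IsExecution S.overlay Δ T)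
    (hS : S.round = 2 * T + Δ + 1) {w : ℕ} (hlive : ∀ q, R.Live T (S.chain w q))
    {x t₀ : ℕ} (hx : ∀ i, R.InputBy i (.tx x) t₀) (ht₀ : t₀ + T ≤ S.time w 0)
    (f : ℕ → Ledger k → Option (List ℕ)) (q : ℕ) :
    ∀ o t, R.Active o t → S.time w (q + 1) ≤ t →
      ∃ v, S.relayed f w q (R.view o t (S.chain w q)) = some v ∧ x ∈ v := by
  induction q with
  | zero =>
    intro o t ho ht
    have ht1 := S.time_add_round w 0
    have hrep : ∀ q < S.last + 1,
        S.reports w (cut (S.time w 1) (R.view o t (S.chain w 0))) (S.chain w q) ≠ [] := by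
      intro q _
      obtain ⟨a, ha, hcl, hpost⟩ := hR.exists_snapshot hS (hlive q) (S.time w 0)
      obtain ⟨B, hB, hBt, he⟩ := hpost _ (hlive 0) o t ho (by rw [ht1]; exact ht)
      rw [ht1] at hBt
      exact List.ne_nil_of_mem (S.mem_reports.2 ⟨⟨B, mem_cut.2 ⟨hB, hBt⟩, he⟩, hcl⟩)
    rw [Schedule.relayed, Schedule.proposal, if_pos hrep]
    refine ⟨_, rfl, ?_⟩
    simp only [zero_add] at ht ht1
    obtain ⟨B, hB, he, hBt⟩ := (hR.epochs _ (hlive 0)).2.1 _ _ (hx _) o t ho (by omega)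
    have hmem : x ∈ transactions (cut (S.time w 1) (R.view o t (S.chain w 0))) :=
      mem_transactions.2 ⟨B, mem_cut.2 ⟨hB, by omega⟩, he⟩
    -- The proposal appends only transactions that the inherited value lacks, so `x` is in one part
    -- or the other.
    by_cases hl : x ∈ S.latest f w (cut (S.time w 1) (R.view o t (S.chain w 0))) w
    · exact List.mem_append_left _ hl
    · exact List.mem_append_right _ (List.mem_filter.2 ⟨hmem, by simpa using hl⟩)
  | succ q ih =>
    intro o t ho ht
    obtain ⟨v, hv, hxv⟩ := hR.exists_mem_values hS (hlive q) (hlive (q + 1)) ih ho ht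
    exact ⟨_, S.relayed_succ_eq_some.2 ⟨List.ne_nil_of_mem hv, rfl⟩, mem_merge.2 ⟨v, hv, hxv⟩⟩

theorem IsExecution.mem_overlayLedger (hR : R.IsExecution S.overlay Δ T)
    (hS : S.round = 2 * T + Δ + 1) {w : ℕ} (hlive : ∀ q, R.Live T (S.chain w q))
    {x t₀ : ℕ} (hx : ∀ i, R.InputBy i (.tx x) t₀) (ht₀ : t₀ + T ≤ S.time w 0)
    {c t : ℕ} (hc : R.online c t) (ht : S.time w (S.last + 2) ≤ t) :
    x ∈ R.overlayLedger S.overlay c t := by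
  have hg : ∀ o t, R.Active o t → S.time w (S.last + 1) ≤ t →
      ∃ v, S.prepared w (R.view o t (S.chain w S.last)) = some v ∧ x ∈ v := by
    simp only [Schedule.prepared_eq]
    exact hR.exists_relayed hS hlive hx ht₀ (S.earlier w) S.last
  have hrec : ∀ q, ∃ v ∈ S.recorded w (R.view (.client c) t (S.chain w q)), x ∈ v := fun q =>
    hR.exists_mem_values hS (hlive S.last) (hlive q) hg (o := .client c) hc ht
  obtain ⟨v, hv, hxv⟩ := hrec 0
  -- A client at time `t` inspects only the attempts below `t + 1`; this suffices since rounds have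
  -- positive length.
  have hw : w < t + 1 := by
    refine Nat.lt_succ_of_le (le_trans ?_ ht)
    exact (Nat.le_mul_of_pos_right w (by omega : 0 < S.last + 3)).trans
      ((Nat.le_add_right _ _).trans (Nat.le_mul_of_pos_right _ (by omega)))
  refine mem_merge.2 ⟨v, S.mem_allCommitted.2 ⟨_, some_mem_clientHistory.2 ⟨t, le_rfl, hc, rfl⟩,
    w, by rwa [length_clientHistory], S.mem_committed.2 ⟨fun q _ => ?_, 0, by omega, hv⟩⟩, hxv⟩
  obtain ⟨v, hv, -⟩ := hrec q
  exact List.ne_nil_of_mem hv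

theorem IsExecution.overlayLive (hR : R.IsExecution S.overlay Δ T)
    (hS : S.round = 2 * T + Δ + 1) {m : ℕ}
    (hlive : ∀ w₀, ∃ w, w₀ ≤ w ∧ w < w₀ + m ∧ ∀ q, R.Live T (S.chain w q)) :
    R.OverlayLive S.overlay (T + (m + 1) * ((S.last + 3) * S.round)) := by
  intro x t₀ hx c t hc ht
  obtain ⟨w, hw, hwm, hl⟩ := hlive ((t₀ + T) / ((S.last + 3) * S.round) + 1)
  have hpos : 0 < (S.last + 3) * S.round := Nat.mul_pos (by omega) (by omega)
  have hd := Nat.div_add_mod (t₀ + T) ((S.last + 3) * S.round)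
  have hmod := Nat.mod_lt (t₀ + T) hpos
  set A := (S.last + 3) * S.round with hA
  set d := (t₀ + T) / A
  have h0 : S.time w 0 = w * A := by unfold Schedule.time; rw [hA]; ring
  refine hR.mem_overlayLedger hS hl hx ?_ hc ?_
  · rw [h0]
    nlinarith [Nat.mul_le_mul_right A hw]
  · have h1 : S.time w (S.last + 2) ≤ (w + 1) * A := by
      unfold Schedule.time
      rw [hA]
      nlinarith
    have h2 : (w + 1) * A ≤ (d + 1 + m) * A := Nat.mul_le_mul_right A (by omega)
    have h3 : (d + 1 + m) * A = A * d + (m + 1) * A := by ring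
    omega

end Run

end Execution

/-! ### Characterizations -/

section Characterization

variable {k : ℕ}

/-- There are finitely many guarantees, so each element of `V` lies above a minimal one. Domination
thus reduces to containment in the safety and liveness sets. -/
theorem generated_subset_generated_exm {E V : Set (Guarantee k)} (h : E ⊆ V) :
    generated E ⊆ generated (exm V) := by
  rintro w ⟨v, hv, hvw⟩
  obtain ⟨u, huv, hu⟩ := (Set.toFinite V).exists_le_minimal (h hv)
  exact ⟨u, ⟨hu.prop, fun z hz hzu => hu.not_lt hz hzu⟩, huv.trans hvw⟩

/-- The overlay protocol that outputs nothing. -/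
def emptyOverlay (k : ℕ) : Overlay k where
  send _ _ := []
  output _ := []
  output_valid _ _ hx := by simp at hx

/-- A nonempty subset of `Fin k` is enumerated by a sequence, within `k + 1` steps. -/
theorem exists_enumeration {l : Fin k → Bool} (hl : l ≠ fun _ => false) :
    ∃ e : ℕ → Fin k, (∀ q, l (e q) = true) ∧ ∀ i, l i = true → ∃ q < k + 1, e q = i := by
  obtain ⟨i₀, hi₀⟩ : ∃ i, l i = true := by
    by_contra! h
    exact hl (funext fun i => by simpa using h i)
  refine ⟨fun q => if h : ∃ hq : q < k, l ⟨q, hq⟩ = true then ⟨q, h.1⟩ else i₀, fun q => ?_,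
    fun i hi => ⟨i, by omega, dif_pos ⟨i.2, hi⟩⟩⟩
  dsimp only
  split_ifs with h
  exacts [h.2, hi₀]

/-- The elements of a nonempty finite set recur with bounded gaps in some sequence. -/
theorem exists_recurring {α : Type} {E : Set α} (hfin : E.Finite) (hne : E.Nonempty) :
    ∃ (s : ℕ → α) (m : ℕ), (∀ w, s w ∈ E) ∧
      ∀ v ∈ E, ∀ w₀, ∃ w, w₀ ≤ w ∧ w < w₀ + m ∧ s w = v := by
  have := hfin.to_subtype
  have := hne.to_subtype
  obtain ⟨n, ⟨e⟩⟩ := Finite.exists_equiv_fin E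
  have hn : 0 < n := (e (Classical.arbitrary E)).pos
  refine ⟨fun w => e.symm ⟨w % n, Nat.mod_lt w hn⟩, 2 * n, fun w => (e.symm _).2,
    fun v hv w₀ => ?_⟩
  have hc := (e ⟨v, hv⟩).2
  have hd := Nat.div_add_mod w₀ n
  have hmod := Nat.mod_lt w₀ hn
  -- The first multiple of `n` above `w₀` plus an index below `n` stays below `w₀ + 2 * n`.
  refine ⟨n * (w₀ / n + 1) + e ⟨v, hv⟩, by rw [mul_add]; omega, by rw [mul_add]; omega, ?_⟩
  have : (⟨(n * (w₀ / n + 1) + e ⟨v, hv⟩) % n, Nat.mod_lt _ hn⟩ : Fin n) = e ⟨v, hv⟩ :=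
    Fin.ext ((Nat.mul_add_mod _ _ _).trans (Nat.mod_eq_of_lt hc))
  simp only [this, Equiv.symm_apply_apply]

end Characterization

/-- Circuits for synchrony: the achievable security properties of overlay protocols. -/
theorem mainTheorem9 (k Δ T : ℕ) (hΔ : 0 < Δ) (hT : 0 < T)
    (ES EL : Set (Guarantee k))
    (hEL : ∀ v ∈ EL, v.1 = fun _ => false)
    (hne : ((fun _ => false, fun _ => false) : Guarantee k) ∉ EL)
    (hES : ∀ l₁ l₂ s l : Fin k → Bool,
      (fun _ => false, l₁) ∈ EL → (fun _ => false, l₂) ∈ EL → (s, l) ∈ ES →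
        (∃ i ∈ ind l₁, ∃ j ∈ ind l₂,
          s i = true ∧ l i = true ∧ s j = true ∧ l j = true) ∨
        (ind l₁ ∩ ind l₂ ∩ ind s).Nonempty) :
    ∃ P : Overlay k, Dominates (P.characterization Δ T) (ES, EL) := by
  suffices h : ∃ P : Overlay k, ES ⊆ P.safetySet Δ T ∧ EL ⊆ P.livenessSet Δ T by
    obtain ⟨P, h1, h2⟩ := h
    exact ⟨P, generated_subset_generated_exm h1, generated_subset_generated_exm h2⟩
  -- If no liveness is demanded, there are no attempts to schedule, and outputting nothing is always
  -- safe.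
  rcases EL.eq_empty_or_nonempty with rfl | hnonempty
  · exact ⟨emptyOverlay k, fun v _ R _ _ =>
      ⟨fun _ _ _ _ _ _ => Or.inl List.prefix_rfl, fun _ _ _ _ _ _ => List.prefix_rfl⟩,
      Set.empty_subset _⟩
  obtain ⟨g, m, hg, hrec⟩ := exists_recurring EL.toFinite hnonempty
  have hg' : ∀ w, (fun _ => false, (g w).2) ∈ EL := fun w => by
    rw [← hEL _ (hg w)]
    exact hg w
  have hg0 : ∀ w, (g w).2 ≠ fun _ => false := fun w h => hne (h ▸ hg' w)
  choose e he he' using fun w => exists_enumeration (hg0 w)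
  -- Taking `last = k` gives every attempt the same `k + 1` steps, whatever the size of its chain
  -- set; chains may repeat, but only chains of the set occur.
  let S : Schedule k := ⟨k, 2 * T + Δ + 1, e⟩
  refine ⟨S.overlay, fun v hv R hR hmeets => ?_, fun v hv => ?_⟩
  · refine hR.overlaySafe (S := S) rfl fun w w' => ?_
    rcases hES _ _ v.1 v.2 (hg' w) (hg' w') hv with
      ⟨i, hi, j, hj, hsi, hli, hsj, hlj⟩ | ⟨i, ⟨hi, hi'⟩, hs⟩
    · obtain ⟨q, hq, rfl⟩ := he' w i hi
      obtain ⟨q', hq', rfl⟩ := he' w' j hj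
      exact Or.inl ⟨q, hq, q', hq', ⟨hmeets.1 _ hsi, hmeets.2 _ hli⟩,
        hmeets.1 _ hsj, hmeets.2 _ hlj⟩
    · obtain ⟨q, hq, rfl⟩ := he' w i hi
      obtain ⟨q', hq', h⟩ := he' w' _ hi'
      exact Or.inr ⟨q, hq, q', hq', h.symm, hmeets.1 _ hs⟩
  · refine ⟨T + (m + 1) * ((S.last + 3) * S.round), by omega, fun R hR hmeets => ?_⟩
    refine hR.overlayLive (S := S) rfl fun w₀ => ?_
    obtain ⟨w, hw, hwm, h⟩ := hrec v hv w₀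
    exact ⟨w, hw, hwm, fun q => hmeets.2 _ (h ▸ he w q)⟩
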